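/- **Setting.** Let $X_1,X_2,\dots$ be i.i.d. with law $P_0$ on a measurable space $\mathcal X$. Let $\Theta$ be a parameter set, $\theta_0\in\Theta$, and let $p_\theta=\exp\{-l(\theta;\cdot)\}>0$, $\theta\in\Theta$, be measurable exponentiated losses on $\mathcal X$ (not necessarily likelihoods). For each $n$ let $\pi_n\ge 0$ be a prior density on $\Theta$ with $\pi_n(\theta_0)>0$. Let $\boldsymbol w=(w_1,\dots,w_n)$ be random weights with law $\mathbb P_{\boldsymbol w}$, independent of $X^{(n)}=(X_1,\dots,X_n)\sim P_0^{(n)}$. Let $\hat\theta_{\boldsymbol w}$ be a weighted posterior mode, i.e. (almost surely) a maximizer over $\theta\in\Theta$ of $$\sum_{i=1}^n w_i\log p_\theta(X_i)+\log\pi_n(\theta).$$ For a class $\mathcal F$ of functions on $\mathcal X$ let $\mathcal R_n(\mathcal F)=\mathbb E\sup_{f\in\mathcal F}\bigl|\frac1n\sum_{i=1}^n\sigma_i f(X_i)\bigr|$ be its Rademacher complexity, where the $\sigma_i$ are i.i.d. uniform on $\{\pm1\}$ and independent of the $X_i$. Given a semi-metric $d$ on $\Theta$, put $\phi_n(\epsilon)=\sqrt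 n\,\mathcal R_n\bigl(\{\log(p_\theta/p_{\theta_0}):d(\theta,\theta_0)<\epsilon\}\bigr)$. Expectations and probabilities of non-measurable quantities are outer ones. **Theorem.** Let $\epsilon_n>0$ with $\epsilon_n\to0$, and assume the following. 1. $d$ is a semi-metric on $\Theta$ with $P_0\log(p_{\theta_0}/p_\theta)\ge d^2(\theta,\theta_0)$ for all $\theta\in\Theta$ (the expectation existing). 2. $\sup_{\theta\in\Theta}|\log p_\theta(X)|<\infty$ for $P_0$-almost every $X$. 3. Either, for each $n$, the weights $w_1,\dots,w_n$ are i.i.d. from one fixed law with $\mathbb E w_i=1$ and $\|w_i\|_{2,1}=\int_0^\infty\sqrt{P(|w_i|>x)}\,dx<\infty$; or $\boldsymbol w\sim n\times\mathrm{Dir}(c,\dots,c)$ for each $n$, for some fixed $c>0$. 4. There are constants $C>0$ and $\gamma\in(0,2)$ such that for all $1\le k\le n$, all $\epsilon\ge\epsilon_n$ and all $c>1$, $$\phi_k(\epsilon)\le C\sqrt n\,\epsilon^2,\qquad \phi_k(c\epsilon)\le c^\gamma\phi_k(\epsilon).$$ 5. $\epsilon_n^{-2}\phi_n(\epsilon_n)\le\sqrt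 n$ for all $n$, and $$\limsup_{n\to\infty}\ \sup_{\epsilon\ge\epsilon_n}\ \frac{1}{n\epsilon^2}\ \sup_{\theta\in\Theta:\ \epsilon<d(\theta,\theta_0)\le2\epsilon}\log\frac{\pi_n(\theta)}{\pi_n(\theta_0)}\ \le\ 0 .$$ Then for every sequence $M_n\to\infty$, $$P_0^{(n)}\mathbb P_{\boldsymbol w}\bigl(d(\hat\theta_{\boldsymbol w},\theta_0)>M_n\epsilon_n\bigr)\to0\qquad(n\to\infty).$$ -/

import Mathlib

open MeasureTheory ProbabilityTheory Filter Topology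
open scoped ENNReal NNReal

namespace WeightedMode

noncomputable section

/-- Outer expectation of a nonnegative function: the infimum of the expectations of its measurable
majorants. It is the ordinary expectation when the function is measurable; suprema over uncountable
classes need not be. -/
def outerExpectation {Ω : Type*} [MeasurableSpace Ω] (μ : Measure Ω) (f : Ω → ℝ≥0∞) : ℝ≥0∞ :=
  ⨅ (g : Ω → ℝ≥0∞) (_ : Measurable g) (_ : ∀ ω, f ω ≤ g ω), ∫⁻ ω, g ω ∂μ

/-- The law `P₀⁽ⁿ⁾` of an i.i.d. sample of size `n` from `P₀`. -/
def sampleLaw {𝓧 : Type*} [MeasurableSpace 𝓧] (P₀ : Measure 𝓧) (n : ℕ) : Measure (Fin n → 𝓧) :=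
  Measure.pi fun _ : Fin n => P₀

/-- Rademacher complexity of the class `F` with respect to `P₀` at sample size `n`: the (outer)
expectation of `sup_{f ∈ F} |n⁻¹ ∑ σᵢ f(Xᵢ)|`, the `Xᵢ` being i.i.d. from `P₀` and the signs `σᵢ`
independent of them and uniform on `{1, -1}ⁿ`. -/
def rademacherComplexity {𝓧 : Type*} [MeasurableSpace 𝓧] (P₀ : Measure 𝓧) (n : ℕ)
    (F : Set (𝓧 → ℝ)) : ℝ≥0∞ :=
  (2 ^ n : ℝ≥0∞)⁻¹ * ∑ σ : Fin n → ℤˣ,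
    outerExpectation (sampleLaw P₀ n) fun x =>
      ⨆ f ∈ F, ENNReal.ofReal |(n : ℝ)⁻¹ * ∑ i, ((σ i : ℤ) : ℝ) * f (x i)|

/-- A semi-metric: nonnegative, symmetric and zero on the diagonal. Neither the triangle inequality
nor separation of points is required, so that every usage of the word is covered. -/
structure IsSemimetric {Θ : Type*} (d : Θ → Θ → ℝ) : Prop where
  nonneg : ∀ θ θ', 0 ≤ d θ θ'
  symm : ∀ θ θ', d θ θ' = d θ' θ
  self : ∀ θ, d θ θ = 0

/-- The class `{log (p_θ / p_{θ₀}) : d(θ, θ₀) < ε}`. -/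
def localClass {𝓧 Θ : Type*} (p : Θ → 𝓧 → ℝ) (d : Θ → Θ → ℝ) (θ₀ : Θ) (ε : ℝ) :
    Set (𝓧 → ℝ) :=
  (fun θ x => Real.log (p θ x / p θ₀ x)) '' {θ | d θ θ₀ < ε}

/-- `φₙ(ε) = √n` times the Rademacher complexity of the local class. -/
def phi {𝓧 Θ : Type*} [MeasurableSpace 𝓧] (P₀ : Measure 𝓧) (p : Θ → 𝓧 → ℝ) (d : Θ → Θ → ℝ)
    (θ₀ : Θ) (n : ℕ) (ε : ℝ) : ℝ≥0∞ :=
  ENNReal.ofReal (Real.sqrt n) * rademacherComplexity P₀ n (localClass p d θ₀ ε)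

/-- The norm `‖w‖_{2,1} = ∫₀^∞ √(P(|w| > x)) dx` of a real random variable with law `ν`. -/
def norm21 (ν : Measure ℝ) : ℝ≥0∞ :=
  ∫⁻ x in Set.Ioi (0 : ℝ), (ν {y | x < |y|}) ^ (1 / 2 : ℝ)

/-- The law `n × Dir(c, …, c)` on `ℝⁿ`: that of `n zᵢ / ∑ⱼ zⱼ` for i.i.d. `zᵢ ∼ Gamma(c, 1)`. -/
def scaledDirichlet (n : ℕ) (c : ℝ) : Measure (Fin n → ℝ) :=
  (Measure.pi fun _ : Fin n => gammaMeasure c 1).map fun z i => n * (z i / ∑ j, z j)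

/-- For every `n` the weights `w₁, …, wₙ` are i.i.d. from one fixed law with mean `1` and finite
`L_{2,1}` norm. -/
def IsIIDWeightLaw (Q : (n : ℕ) → Measure (Fin n → ℝ)) : Prop :=
  ∃ ν : Measure ℝ, IsProbabilityMeasure ν ∧ Integrable (fun y => y) ν ∧ ∫ y, y ∂ν = 1 ∧
    norm21 ν < ∞ ∧ ∀ n, Q n = Measure.pi fun _ : Fin n => ν

/-- For every `n` the weight vector has law `n × Dir(c, …, c)`, for one fixed `c > 0`. -/
def IsDirichletWeightLaw (Q : (n : ℕ) → Measure (Fin n → ℝ)) : Prop :=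
  ∃ c : ℝ, 0 < c ∧ ∀ n, Q n = scaledDirichlet n c

/-- The weighted log-posterior `∑ wᵢ log p_θ(xᵢ) + log π(θ)` (up to a constant). It takes the value
`-∞` where the prior density vanishes. -/
def logPosterior {𝓧 Θ : Type*} (p : Θ → 𝓧 → ℝ) (prior : Θ → ℝ≥0) {n : ℕ} (x : Fin n → 𝓧)
    (w : Fin n → ℝ) (θ : Θ) : EReal :=
  ((∑ i, w i * Real.log (p θ (x i)) : ℝ) : EReal) + ENNReal.log (prior θ)

/-- `θ` is a weighted posterior mode: a global maximizer of the weighted log-posterior. -/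
def IsMode {𝓧 Θ : Type*} (p : Θ → 𝓧 → ℝ) (prior : Θ → ℝ≥0) {n : ℕ} (x : Fin n → 𝓧)
    (w : Fin n → ℝ) (θ : Θ) : Prop :=
  ∀ θ', logPosterior p prior x w θ' ≤ logPosterior p prior x w θ

/-- `sup_{ε ≥ εₙ} (n ε²)⁻¹ sup_{ε < d(θ, θ₀) ≤ 2ε} log (π(θ) / π(θ₀))` with `e = ε`, `r = εₙ`, as an
extended real number (the supremum over the empty set is `-∞`). -/
def priorRatio {Θ : Type*} (prior : Θ → ℝ≥0) (d : Θ → Θ → ℝ) (θ₀ : Θ) (n : ℕ) (r : ℝ) : EReal :=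
  ⨆ (e : ℝ) (_ : r ≤ e),
    (⨆ (θ : Θ) (_ : e < d θ θ₀ ∧ d θ θ₀ ≤ 2 * e),
      ENNReal.log ((prior θ : ℝ≥0∞) / (prior θ₀ : ℝ≥0∞))) / ((n * e ^ 2 : ℝ) : EReal)

end

end WeightedMode

open WeightedMode

/-! A mode at distance between `e` and `2e` from `θ₀` satisfies the basic inequality `0 ≤ ∑ wᵢ log
(p_θ / p_θ₀)(Xᵢ) + log (π(θ) / π(θ₀))`. With `m > 0` the mean weight, the sum has expectation at
most `-n m e²`, and the prior term is eventually at most a small multiple of `n e²`. The centred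
weighted sum must then exceed `m n e² / 2` somewhere on the shell. Its expected supremum is at most
`4 √n ‖w‖_{2,1} B`, where `B` bounds `φ_k(4e)` for all `1 ≤ k ≤ n`. For `e = t εₙ` growth allows `B`
of order `√n εₙ² t^γ`, so Markov's inequality gives the shell probability `O(t^(γ-2))`. Since `γ <
2`, the sum over `t = 2^j Mₙ` is geometric and vanishes as `Mₙ → ∞` (`measure_shell_le`,
`tendsto_of_basic_inequality`).

The supremum bound (`exists_weighted_sum_majorant`) comes from symmetrizing the pairs `(Xᵢ, wᵢ)` and
slicing the multipliers by level: `∑ σᵢ wᵢ⁺ f(Xᵢ)` is the integral over `t > 0` of the signed sums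
over the random set `{i : wᵢ > t}`. Given that this set has `k` elements, the inner supremum costs
`k` times the Rademacher complexity at `k`, at most `√k B`. Moreover `E √k ≤ √n P(|w| > t)^(1/2)`,
which integrates to the `L_{2,1}` norm.

Dirichlet weights are normalized i.i.d. gamma variables. Multiplying the basic inequality by their
mean restores i.i.d. weights and multiplies the prior term by a tight factor. Outer expectations are
handled through measurable majorants. -/

namespace WeightedMode

/-! ### Measurable majorants and subsamples -/

/-- The infimum defining the outer expectation is attained. -/
theorem exists_measurable_majorant {Ω : Type*} [MeasurableSpace Ω] (μ : Measure Ω)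
    (f : Ω → ℝ≥0∞) :
    ∃ g : Ω → ℝ≥0∞, Measurable g ∧ (∀ ω, f ω ≤ g ω) ∧
      ∫⁻ ω, g ω ∂μ ≤ outerExpectation μ f := by
  set A : Set ℝ≥0∞ := {a | ∃ g : Ω → ℝ≥0∞, Measurable g ∧ (∀ ω, f ω ≤ g ω) ∧ ∫⁻ ω, g ω ∂μ = a}
    with hA
  have hne : A.Nonempty := ⟨_, fun _ => ∞, measurable_const, fun _ => le_top, rfl⟩
  obtain ⟨u, -, hu, hmem⟩ := exists_seq_tendsto_sInf hne (OrderBot.bddBelow A)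
  choose g hgm hgf hgu using hmem
  refine ⟨fun ω => ⨅ n, g n ω, Measurable.iInf hgm, fun ω => le_iInf fun n => hgf n ω, ?_⟩
  have hle : ∫⁻ ω, ⨅ n, g n ω ∂μ ≤ sInf A := by
    refine ge_of_tendsto' hu fun n => ?_
    rw [← hgu n]
    exact lintegral_mono fun ω => iInf_le _ n
  refine hle.trans ?_
  unfold outerExpectation
  exact le_iInf fun h => le_iInf fun hm => le_iInf fun hf => sInf_le ⟨h, hm, hf, rfl⟩

/-- Selecting distinct coordinates of an i.i.d. vector preserves the product law. -/
theorem measurePreserving_comp_of_injective {ι κ Y : Type*} [Fintype ι] [Fintype κ]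
    [MeasurableSpace Y] (P : Measure Y) [IsProbabilityMeasure P] {e : κ → ι}
    (he : Function.Injective e) :
    MeasurePreserving (fun (y : ι → Y) (j : κ) => y (e j)) (Measure.pi fun _ : ι => P)
      (Measure.pi fun _ : κ => P) := by
  refine ⟨by fun_prop, ?_⟩
  have h : iIndepFun (fun (i : ι) (y : ι → Y) => y i) (Measure.pi fun _ : ι => P) :=
    iIndepFun_pi (X := fun _ y => y) (fun _ => aemeasurable_id)
  have h2 := (iIndepFun_iff_map_fun_eq_pi_map
    (fun j => (measurable_pi_apply (e j)).aemeasurable)).1 (h.precomp he)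
  rw [h2]
  congr 1
  funext j
  exact (measurePreserving_eval (fun _ : ι => P) (e j)).map_eq

/-- Averaging over signs on a larger index set a function of the signs on a smaller one. -/
theorem sum_signs_comp {ι κ : Type*} [Fintype ι] [Fintype κ] [DecidableEq ι] [DecidableEq κ]
    {e : κ → ι} (he : Function.Injective e) (h : (κ → ℤˣ) → ℝ≥0∞) :
    (2 ^ Fintype.card κ : ℝ≥0∞)⁻¹ * ∑ τ, h τ =
      (2 ^ Fintype.card ι : ℝ≥0∞)⁻¹ * ∑ σ : ι → ℤˣ, h fun j => σ (e j) := by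
  classical
  let E := Equiv.piEquivPiSubtypeProd (fun i => i ∈ Set.range e) (fun _ : ι => ℤˣ)
  let E₂ : (κ → ℤˣ) ≃ ({i // i ∈ Set.range e} → ℤˣ) :=
    Equiv.arrowCongr (Equiv.ofInjective e he) (Equiv.refl _)
  have hcard : Fintype.card ι =
      Fintype.card κ + Fintype.card {i // i ∉ Set.range e} := by
    have h1 : Fintype.card {i // i ∈ Set.range e} = Fintype.card κ :=
      (Fintype.card_congr (Equiv.ofInjective e he)).symm
    rw [← h1, Fintype.card_subtype_compl]
    have := Fintype.card_subtype_le (fun i => i ∈ Set.range e)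
    omega
  -- Signs off the range of `e` are free and contribute only the number of their choices.
  have hsum : ∑ σ : ι → ℤˣ, h (fun j => σ (e j)) =
      2 ^ Fintype.card {i // i ∉ Set.range e} * ∑ τ, h τ := by
    rw [← E.symm.sum_comp, Fintype.sum_prod_type, ← E₂.sum_comp, Finset.mul_sum]
    refine Finset.sum_congr rfl fun τ _ => ?_
    have : ∀ ρ, h (fun j => E.symm (E₂ τ, ρ) (e j)) = h τ := by
      intro ρ
      congr 1
      funext j
      have hj : (e j) ∈ Set.range e := ⟨j, rfl⟩
      simp only [E, E₂, Equiv.piEquivPiSubtypeProd, Equiv.coe_fn_symm_mk, hj, dif_pos]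
      simp only [Equiv.arrowCongr_apply, Function.comp, Equiv.refl_apply]
      congr 1
      exact (Equiv.ofInjective e he).symm_apply_apply j
    simp only [this, Finset.sum_const, nsmul_eq_mul]
    simp
  rw [hsum, hcard, pow_add, ENNReal.mul_inv (by simp) (by simp), mul_assoc,
    ← mul_assoc _ _ (∑ τ, h τ),
    ENNReal.inv_mul_cancel (by simp) (by simp), one_mul]

/-- Measurable majorants for the signed sums over a subset of the sample. -/
theorem exists_subset_majorant {𝓧 : Type*} [MeasurableSpace 𝓧] (P₀ : Measure 𝓧)
    [IsProbabilityMeasure P₀] (F : Set (𝓧 → ℝ)) {n : ℕ} (B : ℝ≥0∞)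
    (hB : ∀ k, 0 < k → k ≤ n → ENNReal.ofReal (Real.sqrt k) * rademacherComplexity P₀ k F ≤ B)
    (S : Finset (Fin n)) :
    ∃ g : (Fin n → ℤˣ) → (Fin n → 𝓧) → ℝ≥0∞, (∀ σ, Measurable (g σ)) ∧
      (∀ σ x, ∀ f ∈ F, ENNReal.ofReal |∑ i ∈ S, ((σ i : ℤ) : ℝ) * f (x i)| ≤ g σ x) ∧
      ∑ σ, ∫⁻ x, g σ x ∂sampleLaw P₀ n ≤ 2 ^ n * (ENNReal.ofReal (Real.sqrt S.card) * B) := by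
  rcases S.eq_empty_or_nonempty with rfl | hS
  -- The empty set is separate because `hB` covers only positive sample sizes.
  · exact ⟨fun _ _ => 0, fun _ => measurable_const, by simp, by simp⟩
  obtain ⟨k, hk⟩ : ∃ k, S.card = k := ⟨_, rfl⟩
  have hk0 : 0 < k := hk ▸ hS.card_pos
  have hkn : k ≤ n := by simpa [hk] using S.card_le_univ
  let e : Fin k → Fin n := S.orderEmbOfFin hk
  have he : Function.Injective e := (S.orderEmbOfFin hk).injective
  have hsum : ∀ a : Fin n → ℝ, ∑ i ∈ S, a i = ∑ j, a (e j) := by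
    intro a
    rw [← S.map_orderEmbOfFin_univ hk, Finset.sum_map]
    rfl
  choose g hgm hgf hgi using fun τ : Fin k → ℤˣ =>
    exists_measurable_majorant (sampleLaw P₀ k) fun x =>
      ⨆ f ∈ F, ENNReal.ofReal |(k : ℝ)⁻¹ * ∑ i, ((τ i : ℤ) : ℝ) * f (x i)|
  have hmp : MeasurePreserving (fun (y : Fin n → 𝓧) (j : Fin k) => y (e j)) (sampleLaw P₀ n)
    (sampleLaw P₀ k) := measurePreserving_comp_of_injective P₀ he
  -- The factor `k` undoes the normalization in the complexity; `k = √k · √k` then leaves `√k B`.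
  refine ⟨fun σ x => k * g (fun j => σ (e j)) fun j => x (e j), fun σ => ?_, fun σ x f hf => ?_, ?_⟩
  · exact ((hgm _).comp hmp.measurable).const_mul _
  · have h1 := (le_iSup₂ (f := fun f (_ : f ∈ F) => ENNReal.ofReal |(k : ℝ)⁻¹ *
      ∑ i, ((σ (e i) : ℤ) : ℝ) * f (x (e i))|) f hf).trans
        (hgf (fun j => σ (e j)) fun j => x (e j))
    rw [hsum]
    refine le_trans (le_of_eq ?_) (mul_le_mul_right h1 (k : ℝ≥0∞))
    rw [abs_mul, abs_of_nonneg (a := (k : ℝ)⁻¹) (inv_nonneg.2 (Nat.cast_nonneg k)),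
      ENNReal.ofReal_mul (by positivity), ← mul_assoc,
      ← ENNReal.ofReal_natCast, ← ENNReal.ofReal_mul (by positivity),
      mul_inv_cancel₀ (Nat.cast_ne_zero.2 hk0.ne')]
    simp
  · have h1 : ∀ σ : Fin n → ℤˣ, ∫⁻ x, k * g (fun j => σ (e j)) (fun j => x (e j)) ∂sampleLaw P₀ n
        = k * ∫⁻ y, g (fun j => σ (e j)) y ∂sampleLaw P₀ k := by
      intro σ
      rw [lintegral_const_mul (k : ℝ≥0∞)
        (f := fun x : Fin n → 𝓧 => g (fun j => σ (e j)) fun j => x (e j))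
        ((hgm _).comp hmp.measurable), hmp.lintegral_comp (hgm _)]
    simp only [h1, ← Finset.mul_sum]
    have h2 := sum_signs_comp he fun τ => ∫⁻ y, g τ y ∂sampleLaw P₀ k
    simp only [Fintype.card_fin] at h2
    have h3 : ∑ σ : Fin n → ℤˣ, ∫⁻ y, g (fun j => σ (e j)) y ∂sampleLaw P₀ k
        = 2 ^ n * ((2 ^ k : ℝ≥0∞)⁻¹ * ∑ τ, ∫⁻ y, g τ y ∂sampleLaw P₀ k) := by
      rw [h2, ← mul_assoc, ENNReal.mul_inv_cancel (by simp) (by simp), one_mul]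
    rw [h3, mul_left_comm]
    refine mul_le_mul_right ?_ _
    have h4 : (2 ^ k : ℝ≥0∞)⁻¹ * ∑ τ, ∫⁻ y, g τ y ∂sampleLaw P₀ k ≤ rademacherComplexity P₀ k F :=
      mul_le_mul_right (Finset.sum_le_sum fun τ _ => hgi τ) _
    rw [hk]
    refine le_trans (le_trans (mul_le_mul_right h4 _) (le_of_eq ?_))
      (mul_le_mul_right (hB k hk0 hkn) _)
    rw [← mul_assoc, ← ENNReal.ofReal_mul (by positivity), Real.mul_self_sqrt (by positivity),
      ENNReal.ofReal_natCast]

/-! ### The multiplier inequality -/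

/-- Layer cake representation of a sum with nonnegative multipliers `uᵢ⁺`. -/
theorem ofReal_abs_sum_posPart_le {ι : Type*} [Fintype ι] (c u : ι → ℝ) :
    ENNReal.ofReal |∑ i, c i * max (u i) 0| ≤
      ∫⁻ t in Set.Ioi (0 : ℝ), ENNReal.ofReal |∑ i with t < u i, c i| := by
  have hint : ∀ i, Integrable ((Set.Iio (u i)).indicator fun _ => c i)
      (volume.restrict (Set.Ioi (0 : ℝ))) := by
    intro i
    rw [integrable_indicator_iff measurableSet_Iio, IntegrableOn,
      Measure.restrict_restrict measurableSet_Iio, Set.inter_comm, Set.Ioi_inter_Iio]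
    exact integrableOn_const (by simp)
  have hval : ∀ i, ∫ t in Set.Ioi (0 : ℝ), (Set.Iio (u i)).indicator (fun _ => c i) t =
      c i * max (u i) 0 := by
    intro i
    rw [setIntegral_indicator measurableSet_Iio, Set.Ioi_inter_Iio, setIntegral_const,
      Real.volume_real_Ioo, sub_zero, smul_eq_mul, mul_comm]
  have hsum : ∀ t : ℝ, ∑ i, (Set.Iio (u i)).indicator (fun _ => c i) t =
      ∑ i with t < u i, c i := by
    intro t
    rw [Finset.sum_filter]
    rfl
  have key : ∑ i, c i * max (u i) 0 = ∫ t in Set.Ioi (0 : ℝ), ∑ i with t < u i, c i := by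
    simp only [← hsum]
    rw [integral_finsetSum _ fun i _ => hint i]
    exact Finset.sum_congr rfl fun i _ => (hval i).symm
  rw [key, ← Real.norm_eq_abs, ofReal_norm]
  refine (enorm_integral_le_lintegral_enorm _).trans (lintegral_mono fun t => ?_)
  rw [← ofReal_norm, Real.norm_eq_abs]

/-- With `sum_ite_mem_iff`, this shows that quantities depending on a random index set are
measurable: they are finite sums over the possible values of the set. -/
theorem measurableSet_setOf_mem_iff_lt {α ι : Type*} [MeasurableSpace α] [Fintype ι]
    {h k : ι → α → ℝ} (hh : ∀ i, Measurable (h i)) (hk : ∀ i, Measurable (k i)) (S : Finset ι) :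
    MeasurableSet {z | ∀ i, i ∈ S ↔ h i z < k i z} := by
  simp only [Set.ofPred_forall]
  refine MeasurableSet.iInter fun i => ?_
  by_cases hi : i ∈ S
  · simpa [hi] using measurableSet_lt (hh i) (hk i)
  · simpa [hi] using measurableSet_le (hk i) (hh i)

theorem sum_ite_mem_iff {ι M : Type*} [Fintype ι] [DecidableEq ι] [AddCommMonoid M]
    (q : ι → Prop) [DecidablePred q]
    [∀ S : Finset ι, Decidable (∀ i, i ∈ S ↔ q i)] (g : Finset ι → M) :
    (∑ S, if ∀ i, i ∈ S ↔ q i then g S else 0) = g (Finset.univ.filter q) := by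
  rw [Finset.sum_eq_single (Finset.univ.filter q)]
  · simp
  · intro S _ hS
    rw [if_neg]
    intro h
    exact hS (by ext i; simp [h])
  · simp

theorem measurable_sqrt_card {n : ℕ} {a : ℝ → ℝ} (ha : Measurable a) (t : ℝ) :
    Measurable fun v : Fin n → ℝ =>
      ENNReal.ofReal (Real.sqrt (Finset.card {i | t < a (v i)})) := by
  have : (fun v : Fin n → ℝ => ((Finset.card {i | t < a (v i)} : ℕ) : ℝ)) = fun v =>
      ∑ i, Set.indicator {v : Fin n → ℝ | t < a (v i)} (fun _ => (1 : ℝ)) v := by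
    funext v
    rw [Finset.card_filter]
    push_cast
    rfl
  have hm : Measurable (fun v : Fin n → ℝ => ((Finset.card {i | t < a (v i)} : ℕ) : ℝ)) := by
    rw [this]
    exact Finset.measurable_sum _ fun i _ =>
      measurable_const.indicator (measurableSet_lt measurable_const (by fun_prop))
  exact hm.sqrt.ennreal_ofReal

/-- The number of large weights has a square root of expectation at most `√n √P(|w| > t)`. -/
theorem lintegral_sqrt_card_le {n : ℕ} (ν : Measure ℝ) [IsProbabilityMeasure ν] {a : ℝ → ℝ}
    (ha : Measurable a) (hale : ∀ y, a y ≤ |y|) (t : ℝ) :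
    ∫⁻ v, ENNReal.ofReal (Real.sqrt (Finset.card {i | t < a (v i)}))
        ∂Measure.pi (fun _ : Fin n => ν) ≤
      ENNReal.ofReal (Real.sqrt n) * ν {y | t < |y|} ^ (1 / 2 : ℝ) := by
  set μ := Measure.pi (fun _ : Fin n => ν)
  set N : (Fin n → ℝ) → ℝ≥0∞ := fun v =>
    ∑ i, Set.indicator {v : Fin n → ℝ | t < a (v i)} (fun _ => 1) v with hN
  have hset : ∀ i : Fin n, MeasurableSet {v : Fin n → ℝ | t < a (v i)} := fun i =>
    measurableSet_lt measurable_const (by fun_prop)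
  have hNm : Measurable N :=
    Finset.measurable_sum _ fun i _ => measurable_const.indicator (hset i)
  have hcard : ∀ v, ((Finset.card {i | t < a (v i)} : ℕ) : ℝ≥0∞) = N v := by
    intro v
    rw [Finset.card_filter, hN]
    push_cast
    rfl
  have hsqrt : ∀ v, ENNReal.ofReal (Real.sqrt (Finset.card {i | t < a (v i)})) =
      N v ^ (1 / 2 : ℝ) := by
    intro v
    rw [← hcard, Real.sqrt_eq_rpow, ← ENNReal.ofReal_rpow_of_nonneg (by positivity) (by norm_num),
      ENNReal.ofReal_natCast]
  simp only [hsqrt]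
  -- Cauchy–Schwarz against the constant `1` gives `E √N ≤ √(E N)`.
  have hold := ENNReal.lintegral_mul_le_Lp_mul_Lq μ (Real.HolderConjugate.two_two)
    (f := fun v => N v ^ (1 / 2 : ℝ)) (g := fun _ => 1) (hNm.pow_const _).aemeasurable
    aemeasurable_const
  have hint : ∫⁻ v, N v ∂μ ≤ n * ν {y | t < |y|} := by
    rw [hN, lintegral_finsetSum _ fun i _ => measurable_const.indicator (hset i)]
    have : ∀ i : Fin n, ∫⁻ v, Set.indicator {v : Fin n → ℝ | t < a (v i)} (fun _ => 1) v ∂μ ≤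
        ν {y | t < |y|} := by
      intro i
      have h := lintegral_indicator_one (μ := μ) (hset i)
      refine (le_of_eq h).trans ?_
      have hm : MeasurableSet {y | t < a y} := measurableSet_lt measurable_const ha
      rw [show {v : Fin n → ℝ | t < a (v i)} = Function.eval i ⁻¹' {y | t < a y} from rfl,
        (measurePreserving_eval (fun _ : Fin n => ν) i).measure_preimage hm.nullMeasurableSet]
      exact measure_mono fun y (hy : t < a y) => lt_of_lt_of_le hy (hale y)
    refine (Finset.sum_le_sum fun i _ => this i).trans ?_
    simp
  have hpow : ∀ v, (N v ^ (1 / 2 : ℝ)) ^ (2 : ℝ) = N v := by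
    intro v
    rw [← ENNReal.rpow_mul]
    norm_num
  simp only [Pi.mul_apply, mul_one, ENNReal.one_rpow, lintegral_const, measure_univ, hpow] at hold
  refine hold.trans ?_
  refine (ENNReal.rpow_le_rpow hint (by norm_num)).trans ?_
  rw [ENNReal.mul_rpow_of_nonneg _ _ (by norm_num), Real.sqrt_eq_rpow,
    ← ENNReal.ofReal_rpow_of_nonneg (by positivity) (by norm_num), ENNReal.ofReal_natCast]

/-- The multiplier inequality: measurable majorants of `|∑ σᵢ a(vᵢ)⁺ f(xᵢ)|` over the class. -/
theorem exists_multiplier_majorant {𝓧 : Type*} [MeasurableSpace 𝓧] (P₀ : Measure 𝓧)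
    [IsProbabilityMeasure P₀] (F : Set (𝓧 → ℝ)) {n : ℕ} (B : ℝ≥0∞)
    (hB : ∀ k, 0 < k → k ≤ n → ENNReal.ofReal (Real.sqrt k) * rademacherComplexity P₀ k F ≤ B)
    (ν : Measure ℝ) [IsProbabilityMeasure ν] {a : ℝ → ℝ}
    (ha : Measurable a) (hale : ∀ y, a y ≤ |y|) :
    ∃ G : (Fin n → ℤˣ) → (Fin n → 𝓧) × (Fin n → ℝ) → ℝ≥0∞, (∀ σ, Measurable (G σ)) ∧
      (∀ σ q, ∀ f ∈ F, ENNReal.ofReal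
        |∑ i, ((σ i : ℤ) : ℝ) * f (q.1 i) * max (a (q.2 i)) 0| ≤ G σ q) ∧
      ∑ σ, ∫⁻ q, G σ q ∂((sampleLaw P₀ n).prod (Measure.pi fun _ : Fin n => ν)) ≤
        2 ^ n * (ENNReal.ofReal (Real.sqrt n) * norm21 ν * B) := by
  have : IsProbabilityMeasure (sampleLaw P₀ n) := by unfold sampleLaw; infer_instance
  set μ := Measure.pi fun _ : Fin n => ν
  choose g hgm hgf hgi using exists_subset_majorant P₀ F B hB
  -- Joint measurability in sample, weights and level permits Tonelli: the sample is integrated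
  -- first, with the index set frozen.
  let L : (Fin n → ℤˣ) → ((Fin n → 𝓧) × (Fin n → ℝ)) × ℝ → ℝ≥0∞ := fun σ z =>
    g {i | z.2 < a (z.1.2 i)} σ z.1.1
  have hL : ∀ σ, Measurable (L σ) := by
    intro σ
    have : L σ = fun z => ∑ S, if ∀ i, i ∈ S ↔ z.2 < a (z.1.2 i) then g S σ z.1.1 else 0 := by
      funext z
      exact (sum_ite_mem_iff (fun i => z.2 < a (z.1.2 i)) fun S => g S σ z.1.1).symm
    rw [this]
    refine Finset.measurable_sum _ fun S _ => Measurable.ite ?_ ?_ measurable_const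
    · exact measurableSet_setOf_mem_iff_lt (fun i => by fun_prop) (fun i => by fun_prop) S
    · exact (hgm S σ).comp (by fun_prop)
  refine ⟨fun σ q => ∫⁻ t in Set.Ioi (0 : ℝ), L σ (q, t), fun σ => ?_, fun σ q f hf => ?_, ?_⟩
  · exact (hL σ).lintegral_prod_right'
  · refine (ofReal_abs_sum_posPart_le _ _).trans (lintegral_mono fun t => ?_)
    exact hgf _ σ q.1 f hf
  · have h1 : ∀ σ, ∫⁻ q, (∫⁻ t in Set.Ioi (0 : ℝ), L σ (q, t)) ∂((sampleLaw P₀ n).prod μ) =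
        ∫⁻ t in Set.Ioi (0 : ℝ), ∫⁻ v, ∫⁻ x, L σ ((x, v), t) ∂sampleLaw P₀ n ∂μ := by
      intro σ
      rw [lintegral_lintegral_swap (hL σ).aemeasurable]
      refine lintegral_congr fun t => ?_
      rw [lintegral_prod_symm _ (by fun_prop)]
    simp only [h1]
    rw [← lintegral_finsetSum]
    swap
    · intro σ _
      have hm : Measurable fun z : ℝ × (Fin n → ℝ) => ∫⁻ x, L σ ((x, z.2), z.1) ∂sampleLaw P₀ n :=
        Measurable.lintegral_prod_right' (f := fun y : (ℝ × (Fin n → ℝ)) × (Fin n → 𝓧) =>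
          L σ ((y.2, y.1.2), y.1.1)) (by fun_prop)
      exact hm.lintegral_prod_right'
    have h2 : ∀ t : ℝ, ∑ σ, ∫⁻ v, ∫⁻ x, L σ ((x, v), t) ∂sampleLaw P₀ n ∂μ ≤
        ν {y | t < |y|} ^ (1 / 2 : ℝ) * (2 ^ n * (ENNReal.ofReal (Real.sqrt n) * B)) := by
      intro t
      rw [← lintegral_finsetSum]
      swap
      · intro σ _
        exact Measurable.lintegral_prod_right' (f := fun y : (Fin n → ℝ) × (Fin n → 𝓧) =>
          L σ ((y.2, y.1), t)) (by fun_prop)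
      calc _ ≤ ∫⁻ v, ENNReal.ofReal (Real.sqrt (Finset.card {i | t < a (v i)})) * (2 ^ n * B)
              ∂μ := by
            refine lintegral_mono fun v => (hgi {i | t < a (v i)}).trans (le_of_eq (by ring))
        _ ≤ _ := by
            rw [lintegral_mul_const _ (measurable_sqrt_card ha t)]
            refine (mul_le_mul_left (lintegral_sqrt_card_le ν ha hale t) _).trans (le_of_eq ?_)
            ring
    refine (lintegral_mono fun t => h2 t).trans ?_
    rw [lintegral_mul_const]
    · refine le_of_eq ?_
      rw [norm21]
      ring
    · refine Measurable.pow_const (Antitone.measurable fun t t' htt' => ?_) _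
      exact measure_mono fun y (hy : t' < |y|) => htt'.trans_lt hy

/-! ### Symmetrization and the maximal inequality -/

/-- The coordinatewise identification of pairs of vectors with vectors of pairs, for i.i.d.
coordinates. -/
theorem measurePreserving_zip {ι Y Z : Type*} [Fintype ι] [MeasurableSpace Y] [MeasurableSpace Z]
    (P : Measure Y) (R : Measure Z) [IsProbabilityMeasure P] [IsProbabilityMeasure R] :
    MeasurePreserving (fun (q : (ι → Y) × (ι → Z)) (i : ι) => (q.1 i, q.2 i))
      ((Measure.pi fun _ : ι => P).prod (Measure.pi fun _ : ι => R))
      (Measure.pi fun _ : ι => P.prod R) :=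
  (measurePreserving_arrowProdEquivProdArrow Y Z ι (fun _ => P) (fun _ => R)).symm

/-- Exchanging coordinates between two independent copies of an i.i.d. vector. -/
theorem measurePreserving_mix {ι Y : Type*} [Fintype ι] [MeasurableSpace Y] (P : Measure Y)
    [IsProbabilityMeasure P] (s : ι → Prop) [DecidablePred s] :
    MeasurePreserving (fun (q : (ι → Y) × (ι → Y)) (i : ι) => if s i then q.1 i else q.2 i)
      ((Measure.pi fun _ : ι => P).prod (Measure.pi fun _ : ι => P))
      (Measure.pi fun _ : ι => P) := by
  have h : MeasurePreserving (fun (y : ι → Y × Y) (i : ι) => if s i then (y i).1 else (y i).2)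
      (Measure.pi fun _ : ι => P.prod P) (Measure.pi fun _ : ι => P) := by
    refine measurePreserving_pi (f := fun i (z : Y × Y) => if s i then z.1 else z.2) _ _ fun i => ?_
    by_cases hi : s i
    · simpa [hi] using measurePreserving_fst
    · simpa [hi] using measurePreserving_snd
  exact h.comp (measurePreserving_zip P P)

/-- Symmetrization: a majorant of the signed sums, for a single choice of the signs, yields a
majorant of the centred sums. -/
theorem exists_symmetrization_majorant {ι Y : Type*} [Fintype ι] [MeasurableSpace Y]
    (ρ : Measure Y) [IsProbabilityMeasure ρ] (F : Set (Y → ℝ)) (hF : ∀ m ∈ F, Integrable m ρ)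
    (σ : ι → ℤˣ) {G : (ι → Y) → ℝ≥0∞} (hG : Measurable G)
    (hFG : ∀ y, ∀ m ∈ F, ENNReal.ofReal |∑ i, ((σ i : ℤ) : ℝ) * m (y i)| ≤ G y) :
    ∃ H : (ι → Y) → ℝ≥0∞, Measurable H ∧
      (∀ y, ∀ m ∈ F, ENNReal.ofReal |∑ i, m (y i) - Fintype.card ι * ∫ z, m z ∂ρ| ≤ H y) ∧
      ∫⁻ y, H y ∂Measure.pi (fun _ => ρ) ≤ 2 * ∫⁻ y, G y ∂Measure.pi (fun _ => ρ) := by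
  classical
  set μ := Measure.pi (fun _ : ι => ρ) with hμ
  -- `A` and `A'` exchange the two copies where the sign is `-1`. Both keep the product law, and
  -- `m(yᵢ) - m(y'ᵢ) = σᵢ (m(Aᵢ) - m(A'ᵢ))` for fixed signs.
  let A : (ι → Y) × (ι → Y) → ι → Y := fun q i => if σ i = 1 then q.1 i else q.2 i
  let A' : (ι → Y) × (ι → Y) → ι → Y := fun q i => if ¬ σ i = 1 then q.1 i else q.2 i
  have hA : MeasurePreserving A (μ.prod μ) μ := measurePreserving_mix ρ _
  have hA' : MeasurePreserving A' (μ.prod μ) μ := measurePreserving_mix ρ _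
  have hGA : Measurable fun q => G (A q) := hG.comp hA.measurable
  have hGA' : Measurable fun q => G (A' q) := hG.comp hA'.measurable
  refine ⟨fun y => ∫⁻ y', G (A (y, y')) + G (A' (y, y')) ∂μ,
    (hGA.add hGA').lintegral_prod_right', fun y m hm => ?_, ?_⟩
  · have hint : ∀ i, Integrable (fun y' : ι → Y => m (y' i)) μ := fun i =>
      (measurePreserving_eval (fun _ : ι => ρ) i).integrable_comp_of_integrable (hF m hm)
    have hval : ∀ i, ∫ y', m (y' i) ∂μ = ∫ z, m z ∂ρ := by
      intro i
      have he := measurePreserving_eval (fun _ : ι => ρ) i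
      have h := integral_map (φ := Function.eval i) (f := m) he.measurable.aemeasurable
        (by rw [he.map_eq]; exact (hF m hm).aestronglyMeasurable)
      rw [he.map_eq] at h
      exact h.symm
    have hsplit : ∑ i, m (y i) - Fintype.card ι * ∫ z, m z ∂ρ =
        ∫ y', ∑ i, (m (y i) - m (y' i)) ∂μ := by
      rw [integral_finsetSum (f := fun i (y' : ι → Y) => m (y i) - m (y' i)) _ fun i _ =>
        (integrable_const _).sub (hint i)]
      simp only [integral_sub (integrable_const _) (hint _), hval]
      simp
    rw [hsplit, ← Real.norm_eq_abs, ofReal_norm]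
    refine (enorm_integral_le_lintegral_enorm _).trans (lintegral_mono fun y' => ?_)
    have hswap : ∑ i, (m (y i) - m (y' i)) = ∑ i, ((σ i : ℤ) : ℝ) * m (A (y, y') i) -
        ∑ i, ((σ i : ℤ) : ℝ) * m (A' (y, y') i) := by
      rw [← Finset.sum_sub_distrib]
      refine Finset.sum_congr rfl fun i _ => ?_
      rcases Int.units_eq_one_or (σ i) with h | h
      · simp [A, A', h]
      · simp [A, A', h, show (-1 : ℤˣ) ≠ 1 by decide]
        ring
    rw [← ofReal_norm, Real.norm_eq_abs, hswap]
    refine (ENNReal.ofReal_le_ofReal (abs_sub _ _)).trans ?_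
    rw [ENNReal.ofReal_add (abs_nonneg _) (abs_nonneg _)]
    exact add_le_add (hFG _ m hm) (hFG _ m hm)
  · refine le_of_eq ?_
    have h := lintegral_prod (μ := μ) (ν := μ) _ (hGA.add hGA').aemeasurable
    simp only [Pi.add_apply] at h
    rw [← h, lintegral_add_left hGA, hA.lintegral_comp hG, hA'.lintegral_comp hG, two_mul]

/-- The maximal inequality for centred weighted sums `∑ vᵢ f(xᵢ) - n (E v) (P₀ f)`. -/
theorem exists_weighted_sum_majorant {𝓧 : Type*} [MeasurableSpace 𝓧] (P₀ : Measure 𝓧)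
    [IsProbabilityMeasure P₀] (F : Set (𝓧 → ℝ)) (hF : ∀ f ∈ F, Integrable f P₀) {n : ℕ} (B : ℝ≥0∞)
    (hB : ∀ k, 0 < k → k ≤ n → ENNReal.ofReal (Real.sqrt k) * rademacherComplexity P₀ k F ≤ B)
    (ν : Measure ℝ) [IsProbabilityMeasure ν] (hν : Integrable (fun y => y) ν) :
    ∃ H : (Fin n → 𝓧) × (Fin n → ℝ) → ℝ≥0∞, Measurable H ∧
      (∀ q, ∀ f ∈ F, ENNReal.ofReal
        |∑ i, q.2 i * f (q.1 i) - n * ((∫ y, y ∂ν) * ∫ x, f x ∂P₀)| ≤ H q) ∧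
      ∫⁻ q, H q ∂((sampleLaw P₀ n).prod (Measure.pi fun _ : Fin n => ν)) ≤
        4 * (ENNReal.ofReal (Real.sqrt n) * norm21 ν * B) := by
  set K := ENNReal.ofReal (Real.sqrt n) * norm21 ν * B with hK
  set μ := (sampleLaw P₀ n).prod (Measure.pi fun _ : Fin n => ν) with hμ
  obtain ⟨G₁, hG₁m, hG₁, hG₁i⟩ := exists_multiplier_majorant P₀ F B hB ν
    measurable_id (fun y => le_abs_self y)
  obtain ⟨G₂, hG₂m, hG₂, hG₂i⟩ := exists_multiplier_majorant P₀ F B hB ν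
    measurable_neg (fun y => neg_le_abs y)
  -- Some sign vector does no worse than the average, and symmetrization needs only one.
  obtain ⟨σ, hσ⟩ : ∃ σ : Fin n → ℤˣ, ∫⁻ q, G₁ σ q + G₂ σ q ∂μ ≤ 2 * K := by
    obtain ⟨σ, -, hmin⟩ := Finset.exists_min_image (Finset.univ : Finset (Fin n → ℤˣ))
      (fun σ => ∫⁻ q, G₁ σ q + G₂ σ q ∂μ) Finset.univ_nonempty
    refine ⟨σ, ?_⟩
    have h1 := Finset.card_nsmul_le_sum _ _ _ hmin
    have h2 : ∑ σ, ∫⁻ q, G₁ σ q + G₂ σ q ∂μ ≤ 2 ^ n * (2 * K) := by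
      simp only [lintegral_add_left (hG₁m _), Finset.sum_add_distrib]
      refine (add_le_add hG₁i hG₂i).trans (le_of_eq (by ring))
    have h3 := h1.trans h2
    simp only [Finset.card_univ, Fintype.card_pi, Fintype.card_units_int, Finset.prod_const,
      Fintype.card_fin, nsmul_eq_mul, Nat.cast_pow, Nat.cast_ofNat] at h3
    exact (ENNReal.mul_le_mul_iff_right (by simp) (by simp)).1 h3
  let zip : (Fin n → 𝓧) × (Fin n → ℝ) → Fin n → 𝓧 × ℝ := fun q i => (q.1 i, q.2 i)
  let unzip : (Fin n → 𝓧 × ℝ) → (Fin n → 𝓧) × (Fin n → ℝ) := fun y =>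
    (fun i => (y i).1, fun i => (y i).2)
  have hzip : MeasurePreserving zip μ (Measure.pi fun _ => P₀.prod ν) := measurePreserving_zip P₀ ν
  have hunzip : Measurable unzip := by fun_prop
  have hGm : Measurable fun q => G₁ σ q + G₂ σ q := (hG₁m σ).add (hG₂m σ)
  obtain ⟨H, hHm, hH, hHi⟩ := exists_symmetrization_majorant (P₀.prod ν)
    ((fun f z => z.2 * f z.1) '' F)
    (by
      rintro _ ⟨f, hf, rfl⟩
      simpa only [mul_comm] using (hF f hf).mul_prod hν)
    σ (G := fun y => G₁ σ (unzip y) + G₂ σ (unzip y)) (hGm.comp hunzip)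
    (by
      rintro y _ ⟨f, hf, rfl⟩
      -- Slicing by level needs nonnegative multipliers, hence `v = v⁺ - v⁻`.
      have hsplit : ∑ i, ((σ i : ℤ) : ℝ) * ((y i).2 * f (y i).1) =
          ∑ i, ((σ i : ℤ) : ℝ) * f (y i).1 * max (y i).2 0 -
            ∑ i, ((σ i : ℤ) : ℝ) * f (y i).1 * max (-(y i).2) 0 := by
        rw [← Finset.sum_sub_distrib]
        refine Finset.sum_congr rfl fun i _ => ?_
        rw [← mul_sub, max_zero_sub_max_neg_zero_eq_self]
        ring
      change ENNReal.ofReal |∑ i, ((σ i : ℤ) : ℝ) * ((y i).2 * f (y i).1)| ≤ _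
      rw [hsplit]
      refine (ENNReal.ofReal_le_ofReal (abs_sub _ _)).trans ?_
      rw [ENNReal.ofReal_add (abs_nonneg _) (abs_nonneg _)]
      exact add_le_add (hG₁ σ (unzip y) f hf) (hG₂ σ (unzip y) f hf))
  refine ⟨fun q => H (zip q), hHm.comp hzip.measurable, fun q f hf => ?_, ?_⟩
  · have h := hH (zip q) _ ⟨f, hf, rfl⟩
    have hprod : ∫ z : 𝓧 × ℝ, z.2 * f z.1 ∂(P₀.prod ν) = (∫ y, y ∂ν) * ∫ x, f x ∂P₀ := by
      have := integral_prod_mul (μ := P₀) (ν := ν) f (fun y => y)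
      rw [mul_comm, ← this]
      exact integral_congr_ae (ae_of_all _ fun z => mul_comm _ _)
    rw [hprod, Fintype.card_fin] at h
    exact h
  · rw [hzip.lintegral_comp hHm]
    refine hHi.trans ?_
    have h := hzip.lintegral_comp (hGm.comp hunzip)
    simp only [Function.comp_apply] at h
    rw [← h]
    exact (mul_le_mul_right hσ 2).trans (le_of_eq (by ring))

/-! ### Outer measure under an image law -/

/-- For a map out of a standard Borel space, the outer measure of an arbitrary set under the image
law is at most that of its preimage. (The reverse inequality holds for all measurable maps.) -/
theorem prod_map_le_preimage {X Z W : Type*} [MeasurableSpace X] [MeasurableSpace Z]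
    [StandardBorelSpace Z] [Nonempty Z] [MeasurableSpace W] [MeasurableEq W] (P : Measure X)
    [IsProbabilityMeasure P] (μ : Measure Z) [IsProbabilityMeasure μ] {g : Z → W}
    (hg : Measurable g) (A : Set (X × W)) :
    (P.prod (μ.map g)) A ≤ (P.prod μ) ((fun q : X × Z => (q.1, g q.2)) ⁻¹' A) := by
  have : IsProbabilityMeasure (μ.map g) := Measure.isProbabilityMeasure_map hg.aemeasurable
  -- The conditional law of `z` given `g z`; it is concentrated on the fibre of `g`, almost surely.
  set κ : Kernel W Z := condDistrib id g μ with hκ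
  have hcomp : (μ.map g) ⊗ₘ κ = μ.map fun z => (g z, z) :=
    compProd_map_condDistrib measurable_id.aemeasurable
  set B := toMeasurable (P.prod μ) ((fun q : X × Z => (q.1, g q.2)) ⁻¹' A) with hB
  have hBm : MeasurableSet B := measurableSet_toMeasurable _ _
  have hBA : ∀ x z, (x, g z) ∈ A → (x, z) ∈ B := fun x z h => subset_toMeasurable _ _ h
  have hD : ∀ᵐ w ∂μ.map g, ∀ᵐ z ∂κ w, g z = w := by
    have hm : MeasurableSet {q : W × Z | g q.2 = q.1} :=
      measurableSet_eq_fun (hg.comp measurable_snd) measurable_fst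
    refine Measure.ae_ae_of_ae_compProd (p := fun q : W × Z => g q.2 = q.1) ?_
    rw [hcomp, ae_map_iff (by fun_prop) hm]
    exact ae_of_all _ fun _ => rfl
  -- `R` is the conditional probability of the measurable hull `B`. It is `1` almost everywhere on
  -- `A` and integrates to the measure of `B`, so Markov's inequality at level `1` concludes.
  let R : X × W → ℝ≥0∞ := fun q => κ q.2 {z | (q.1, z) ∈ B}
  have hRm : Measurable R := by
    have := Kernel.measurable_kernel_prodMk_left (κ := κ.comap Prod.snd measurable_snd)
      (t := {y : (X × W) × Z | (y.1.1, y.2) ∈ B}) (hBm.preimage (by fun_prop))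
    exact this
  have hle : (P.prod (μ.map g)) A ≤ (P.prod (μ.map g)) {q | 1 ≤ R q} := by
    refine measure_mono_ae ?_
    have hD' : ∀ᵐ q ∂P.prod (μ.map g), ∀ᵐ z ∂κ q.2, g z = q.2 :=
      Measure.quasiMeasurePreserving_snd.ae hD
    filter_upwards [hD'] with q hq hqA
    change 1 ≤ κ q.2 {z | (q.1, z) ∈ B}
    have h1 : ∀ᵐ z ∂κ q.2, (q.1, z) ∈ B := by
      filter_upwards [hq] with z hz
      exact hBA _ _ (by rw [hz]; exact hqA)
    exact ((measure_congr (eventuallyEq_univ.2 h1)).trans measure_univ).ge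
  have hmarkov := mul_meas_ge_le_lintegral (μ := P.prod (μ.map g)) hRm 1
  rw [one_mul] at hmarkov
  refine hle.trans (hmarkov.trans ?_)
  rw [← measure_toMeasurable ((fun q : X × Z => (q.1, g q.2)) ⁻¹' A), ← hB,
    lintegral_prod _ hRm.aemeasurable, Measure.prod_apply hBm]
  refine lintegral_mono fun x => le_of_eq ?_
  have hs : MeasurableSet {z | (x, z) ∈ B} := hBm.preimage (by fun_prop)
  have h2 := Measure.compProd_apply (μ := μ.map g) (κ := κ)
    (s := Prod.snd ⁻¹' {z | (x, z) ∈ B}) (hs.preimage measurable_snd)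
  rw [hcomp, Measure.map_apply (by fun_prop) (hs.preimage measurable_snd)] at h2
  exact h2.symm

/-! ### Moments of the gamma law -/

/-- Exponential tilting of the gamma density. -/
theorem ofReal_exp_half_mul_gammaPDF (c x : ℝ) :
    gammaPDF c 1 x * ENNReal.ofReal (Real.exp (x / 2)) =
      ENNReal.ofReal (2 ^ c) * gammaPDF c (1 / 2) x := by
  rcases lt_or_ge x 0 with hx | hx
  · simp [gammaPDF_of_neg hx]
  · rw [gammaPDF_of_nonneg hx, gammaPDF_of_nonneg hx, ← ENNReal.ofReal_mul' (Real.exp_pos _).le,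
      ← ENNReal.ofReal_mul (by positivity)]
    congr 1
    have h1 : (2 : ℝ) ^ c * (1 / 2) ^ c = 1 := by
      rw [← Real.mul_rpow (by norm_num) (by norm_num)]
      norm_num
    have h2 : Real.exp (-(1 * x)) * Real.exp (x / 2) = Real.exp (-(1 / 2 * x)) := by
      rw [← Real.exp_add]
      ring_nf
    rw [Real.one_rpow, mul_assoc _ (Real.exp _), h2]
    linear_combination -(1 / Real.Gamma c * x ^ (c - 1) * Real.exp (-(1 / 2 * x))) * h1

/-- The tilted density is `2 ^ c` times that of Gamma(c, 1/2). This one exponential moment supplies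
both integrability and the tail bound. -/
theorem lintegral_exp_half_gammaMeasure {c : ℝ} (hc : 0 < c) :
    ∫⁻ x, ENNReal.ofReal (Real.exp (x / 2)) ∂gammaMeasure c 1 = ENNReal.ofReal (2 ^ c) := by
  have hm : ∀ r, Measurable (gammaPDF c r) := fun r =>
    (measurable_gammaPDFReal c r).ennreal_ofReal
  rw [gammaMeasure, lintegral_withDensity_eq_lintegral_mul _ (hm 1) (by fun_prop)]
  simp only [Pi.mul_apply, ofReal_exp_half_mul_gammaPDF]
  rw [lintegral_const_mul _ (hm _), lintegral_gammaPDF_eq_one hc (by norm_num), mul_one]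

theorem ae_pos_gammaMeasure (c r : ℝ) : ∀ᵐ x ∂gammaMeasure c r, 0 < x := by
  have h : gammaMeasure c r (Set.Iio 0) = 0 := by
    rw [gammaMeasure, withDensity_apply _ measurableSet_Iio]
    exact lintegral_gammaPDF_of_nonpos le_rfl
  have h0 : gammaMeasure c r {0} = 0 :=
    withDensity_absolutelyContinuous _ _ (by simp)
  have h1 : ∀ᵐ x ∂gammaMeasure c r, x ∉ Set.Iio 0 := measure_eq_zero_iff_ae_notMem.1 h
  have h2 : ∀ᵐ x ∂gammaMeasure c r, x ∉ ({0} : Set ℝ) := measure_eq_zero_iff_ae_notMem.1 h0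
  filter_upwards [h1, h2] with x hx hx'
  exact lt_of_le_of_ne (not_lt.1 hx) fun h => hx' h.symm

theorem integrable_gammaMeasure {c : ℝ} (hc : 0 < c) :
    Integrable (fun x => x) (gammaMeasure c 1) := by
  have hexp : Integrable (fun x : ℝ => 2 * Real.exp (x / 2)) (gammaMeasure c 1) := by
    refine Integrable.const_mul ⟨by fun_prop, ?_⟩ 2
    rw [hasFiniteIntegral_iff_ofReal (ae_of_all _ fun x => (Real.exp_pos _).le),
      lintegral_exp_half_gammaMeasure hc]
    exact ENNReal.ofReal_lt_top
  refine hexp.mono' (by fun_prop) ?_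
  filter_upwards [ae_pos_gammaMeasure c 1] with x hx
  rw [Real.norm_eq_abs, abs_of_pos hx]
  linarith [Real.add_one_le_exp (x / 2)]

theorem integral_gammaMeasure_pos {c : ℝ} (hc : 0 < c) : 0 < ∫ x, x ∂gammaMeasure c 1 := by
  have := isProbabilityMeasure_gammaMeasure hc one_pos
  have h := ae_pos_gammaMeasure c 1
  rw [integral_pos_iff_support_of_nonneg_ae (h.mono fun x hx => hx.le)
    (integrable_gammaMeasure hc)]
  have h1 : ∀ᵐ x ∂gammaMeasure c 1, x ∈ Function.support fun x : ℝ => x :=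
    h.mono fun x hx => hx.ne'
  have h2 : gammaMeasure c 1 (Function.support fun x : ℝ => x) = 1 :=
    (measure_congr (eventuallyEq_univ.2 h1)).trans measure_univ
  rw [h2]
  exact one_pos

/-- Chernoff's bound `2 ^ c e^(-t/2)` on the tail has an integrable square root, with rate `1/4`. -/
theorem norm21_gammaMeasure_lt_top {c : ℝ} (hc : 0 < c) : norm21 (gammaMeasure c 1) < ∞ := by
  have htail : ∀ t : ℝ, gammaMeasure c 1 {y | t < |y|} ^ (1 / 2 : ℝ) ≤
      ENNReal.ofReal ((2 ^ c) ^ (1 / 2 : ℝ) * Real.exp (-(1 / 4) * t)) := by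
    intro t
    have h1 : gammaMeasure c 1 {y | t < |y|} ≤
        gammaMeasure c 1 {y | ENNReal.ofReal (Real.exp (t / 2)) ≤
          ENNReal.ofReal (Real.exp (y / 2))} := by
      refine measure_mono_ae ?_
      filter_upwards [ae_pos_gammaMeasure c 1] with y hy hty
      have hty' : t < |y| := hty
      rw [abs_of_pos hy] at hty'
      exact ENNReal.ofReal_le_ofReal (Real.exp_le_exp.2 (by linarith))
    have h2 := meas_ge_le_lintegral_div (μ := gammaMeasure c 1)
      (f := fun y => ENNReal.ofReal (Real.exp (y / 2))) (by fun_prop)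
      (ε := ENNReal.ofReal (Real.exp (t / 2))) (by simp [Real.exp_pos]) ENNReal.ofReal_ne_top
    rw [lintegral_exp_half_gammaMeasure hc, ← ENNReal.ofReal_div_of_pos (Real.exp_pos _)] at h2
    refine (ENNReal.rpow_le_rpow (h1.trans h2) (by norm_num)).trans (le_of_eq ?_)
    rw [ENNReal.ofReal_rpow_of_nonneg (by positivity) (by norm_num), div_eq_mul_inv,
      ← Real.exp_neg, Real.mul_rpow (by positivity) (by positivity), ← Real.exp_mul]
    ring_nf
  refine (lintegral_mono htail).trans_lt ?_
  have hint := (integrableOn_exp_mul_Ioi (a := -(1 / 4)) (by norm_num) 0).const_mul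
    (((2 : ℝ) ^ c) ^ (1 / 2 : ℝ))
  have h3 := hint.2
  rwa [hasFiniteIntegral_iff_ofReal (ae_of_all _ fun x => by positivity)] at h3

/-! ### The basic inequality and peeling -/

/-- A weighted posterior mode has positive prior density and satisfies the basic inequality. -/
theorem IsMode.basic_inequality {𝓧 Θ : Type*} {p : Θ → 𝓧 → ℝ} (hp_pos : ∀ θ x, 0 < p θ x)
    {prior : Θ → ℝ≥0} {n : ℕ} {x : Fin n → 𝓧} {w : Fin n → ℝ} {θ θ₀ : Θ}
    (h : IsMode p prior x w θ) (h₀ : 0 < prior θ₀) :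
    0 < prior θ ∧ 0 ≤ ∑ i, w i * Real.log (p θ (x i) / p θ₀ (x i)) +
      Real.log (prior θ / prior θ₀) := by
  have hle := h θ₀
  unfold logPosterior at hle
  rw [ENNReal.log_of_nnreal h₀.ne'] at hle
  have hθ : 0 < prior θ := by
    -- A vanishing prior density would make the maximum `-∞`, below the finite value at `θ₀`.
    by_contra hcon
    have h0 : prior θ = 0 := le_antisymm (not_lt.1 hcon) zero_le
    rw [h0, ENNReal.coe_zero, ENNReal.log_zero, EReal.add_bot, le_bot_iff] at hle
    exact EReal.coe_ne_bot _ hle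
  refine ⟨hθ, ?_⟩
  rw [ENNReal.log_of_nnreal hθ.ne', ← EReal.coe_add, ← EReal.coe_add, EReal.coe_le_coe_iff] at hle
  have hlog : ∀ i, w i * Real.log (p θ (x i) / p θ₀ (x i)) =
      w i * Real.log (p θ (x i)) - w i * Real.log (p θ₀ (x i)) := by
    intro i
    rw [Real.log_div (hp_pos _ _).ne' (hp_pos _ _).ne', mul_sub]
  rw [Finset.sum_congr rfl fun i _ => hlog i, Finset.sum_sub_distrib,
    Real.log_div (NNReal.coe_ne_zero.2 hθ.ne') (NNReal.coe_ne_zero.2 h₀.ne')]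
  linarith

/-- The prior ratio bounds the log-prior increment on the shell `e < d(θ, θ₀) ≤ 2e`. -/
theorem log_prior_le_of_priorRatio_lt {Θ : Type*} {prior : Θ → ℝ≥0} {d : Θ → Θ → ℝ} {θ₀ θ : Θ}
    {n : ℕ} {r e δ : ℝ} (h : priorRatio prior d θ₀ n r < δ) (hn : 0 < n) (hr : r ≤ e) (he : 0 < e)
    (h₁ : e < d θ θ₀) (h₂ : d θ θ₀ ≤ 2 * e) (hθ : 0 < prior θ) (h₀ : 0 < prior θ₀) :
    Real.log (prior θ / prior θ₀) ≤ n * e ^ 2 * δ := by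
  have hpos : (0 : ℝ) < n * e ^ 2 := by positivity
  have hle : (⨆ (θ : Θ) (_ : e < d θ θ₀ ∧ d θ θ₀ ≤ 2 * e),
      ENNReal.log ((prior θ : ℝ≥0∞) / (prior θ₀ : ℝ≥0∞))) / ((n * e ^ 2 : ℝ) : EReal) ≤ δ :=
    le_trans (le_iSup₂ (f := fun (e : ℝ) (_ : r ≤ e) =>
      (⨆ (θ : Θ) (_ : e < d θ θ₀ ∧ d θ θ₀ ≤ 2 * e),
        ENNReal.log ((prior θ : ℝ≥0∞) / (prior θ₀ : ℝ≥0∞))) / ((n * e ^ 2 : ℝ) : EReal)) e hr) h.le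
  rw [EReal.div_le_iff_le_mul (EReal.coe_pos.2 hpos) (EReal.coe_ne_top _), ← EReal.coe_mul] at hle
  have hle2 := le_trans (le_iSup₂ (f := fun (θ : Θ) (_ : e < d θ θ₀ ∧ d θ θ₀ ≤ 2 * e) =>
      ENNReal.log ((prior θ : ℝ≥0∞) / (prior θ₀ : ℝ≥0∞))) θ ⟨h₁, h₂⟩) hle
  rw [← ENNReal.coe_div h₀.ne', ENNReal.log_of_nnreal (div_pos hθ h₀).ne',
    EReal.coe_le_coe_iff] at hle2
  simpa using hle2

/-- Markov's inequality for the weighted empirical process. -/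
theorem measure_exists_le_weighted_sum {𝓧 : Type*} [MeasurableSpace 𝓧] (P₀ : Measure 𝓧)
    [IsProbabilityMeasure P₀] (F : Set (𝓧 → ℝ)) (hF : ∀ f ∈ F, Integrable f P₀) {n : ℕ} (B : ℝ≥0∞)
    (hB : ∀ k, 0 < k → k ≤ n → ENNReal.ofReal (Real.sqrt k) * rademacherComplexity P₀ k F ≤ B)
    (ν : Measure ℝ) [IsProbabilityMeasure ν] (hν : Integrable (fun y => y) ν) {a : ℝ} (ha : 0 < a) :
    ((sampleLaw P₀ n).prod (Measure.pi fun _ : Fin n => ν)) {q | ∃ f ∈ F,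
      a ≤ ∑ i, q.2 i * f (q.1 i) - n * ((∫ y, y ∂ν) * ∫ x, f x ∂P₀)} ≤
      4 * (ENNReal.ofReal (Real.sqrt n) * norm21 ν * B) / ENNReal.ofReal a := by
  obtain ⟨H, hHm, hH, hHi⟩ := exists_weighted_sum_majorant P₀ F hF B hB ν hν
  have h1 := meas_ge_le_lintegral_div
    (μ := (sampleLaw P₀ n).prod (Measure.pi fun _ : Fin n => ν)) hHm.aemeasurable
    (ε := ENNReal.ofReal a) (by simpa using ha) ENNReal.ofReal_ne_top
  refine (measure_mono ?_).trans (h1.trans (ENNReal.div_le_div_right hHi _))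
  rintro q ⟨f, hf, hq⟩
  exact (ENNReal.ofReal_le_ofReal (hq.trans (le_abs_self _))).trans (hH q f hf)

theorem exists_dyadic_shell {r x : ℝ} (hr : 0 < r) (hx : r < x) :
    ∃ j : ℕ, 2 ^ j * r < x ∧ x ≤ 2 * (2 ^ j * r) := by
  have hex : ∃ j : ℕ, x ≤ 2 ^ j * r := by
    obtain ⟨j, hj⟩ := pow_unbounded_of_one_lt (x / r) (one_lt_two : (1 : ℝ) < 2)
    exact ⟨j, ((div_lt_iff₀ hr).1 hj).le⟩
  classical
  have hspec := Nat.find_spec hex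
  -- The least exponent is not `0` because `r < x`; its predecessor indexes the shell.
  obtain ⟨j, hj⟩ : ∃ j, Nat.find hex = j + 1 := by
    refine Nat.exists_eq_succ_of_ne_zero fun h0 => ?_
    rw [h0] at hspec
    simp only [pow_zero, one_mul] at hspec
    linarith
  refine ⟨j, not_le.1 (Nat.find_min hex (by omega)), ?_⟩
  rw [hj, pow_succ] at hspec
  linarith

/-- The probability that some parameter in the shell `e < d(θ, θ₀) ≤ 2e`, `e = tε`, satisfies the
basic inequality up to half of the expected loss. -/
theorem measure_shell_le {𝓧 Θ : Type*} [MeasurableSpace 𝓧]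
    (P₀ : Measure 𝓧) [IsProbabilityMeasure P₀] (p : Θ → 𝓧 → ℝ) (θ₀ : Θ) (d : Θ → Θ → ℝ)
    (hd_le : ∀ θ, Integrable (fun x => Real.log (p θ₀ x / p θ x)) P₀ ∧
      d θ θ₀ ^ 2 ≤ ∫ x, Real.log (p θ₀ x / p θ x) ∂P₀)
    (ν : Measure ℝ) [IsProbabilityMeasure ν] (hν : Integrable (fun y => y) ν)
    (hmean : 0 < ∫ y, y ∂ν) (hN : norm21 ν < ∞)
    {n : ℕ} (hn : 0 < n) {ε C γ : ℝ} (hε : 0 < ε) (hC : 0 < C)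
    (hgrowth : ∀ k : ℕ, 0 < k → k ≤ n → ∀ c : ℝ, 1 < c →
        phi P₀ p d θ₀ k ε ≤ ENNReal.ofReal (C * Real.sqrt n * ε ^ 2) ∧
        phi P₀ p d θ₀ k (c * ε) ≤ ENNReal.ofReal (c ^ γ) * phi P₀ p d θ₀ k ε)
    {t : ℝ} (ht : 1 ≤ t) :
    ((sampleLaw P₀ n).prod (Measure.pi fun _ : Fin n => ν)) {q | ∃ θ,
      t * ε < d θ θ₀ ∧ d θ θ₀ ≤ 2 * (t * ε) ∧
      -((∫ y, y ∂ν) / 2 * (n * (t * ε) ^ 2)) ≤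
        ∑ i, q.2 i * Real.log (p θ (q.1 i) / p θ₀ (q.1 i))} ≤
      ENNReal.ofReal (8 * (norm21 ν).toReal * C * 4 ^ γ / (∫ y, y ∂ν) * t ^ (γ - 2)) := by
  set m := ∫ y, y ∂ν with hm
  have ht0 : 0 < t := by linarith
  have hn' : (0 : ℝ) < n := Nat.cast_pos.2 hn
  have hinv : ∀ θ, (fun x => Real.log (p θ x / p θ₀ x)) =
      fun x => -Real.log (p θ₀ x / p θ x) := by
    intro θ
    funext x
    rw [← Real.log_inv, inv_div]
  -- The local class uses a strict inequality, so radius `2tε` would miss the outer boundary; `4tε`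
  -- contains the shell.
  set F := localClass p d θ₀ (4 * t * ε) with hF
  have hFi : ∀ f ∈ F, Integrable f P₀ := by
    rintro _ ⟨θ, -, rfl⟩
    simp only [hinv θ]
    exact (hd_le θ).1.neg
  set b : ℝ := (4 * t) ^ γ * (C * Real.sqrt n * ε ^ 2) with hb
  have hB : ∀ k, 0 < k → k ≤ n →
      ENNReal.ofReal (Real.sqrt k) * rademacherComplexity P₀ k F ≤ ENNReal.ofReal b := by
    intro k hk hkn
    obtain ⟨h1, h2⟩ := hgrowth k hk hkn (4 * t) (by linarith)
    rw [hb, ENNReal.ofReal_mul (by positivity)]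
    exact h2.trans (mul_le_mul_right h1 _)
  have ha : 0 < m / 2 * (n * (t * ε) ^ 2) := by positivity
  have hmain := measure_exists_le_weighted_sum P₀ F hFi (ENNReal.ofReal b) hB ν hν ha
  refine (measure_mono ?_).trans (hmain.trans (le_of_eq ?_))
  · rintro q ⟨θ, h1, h2, h3⟩
    refine ⟨_, ⟨θ, ?_, rfl⟩, ?_⟩
    · change d θ θ₀ < 4 * t * ε
      have : 0 < t * ε := by positivity
      linarith
    · have hint : ∫ x, Real.log (p θ x / p θ₀ x) ∂P₀ ≤ -(t * ε) ^ 2 := by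
        rw [hinv θ, integral_neg]
        have h4 : (t * ε) ^ 2 ≤ d θ θ₀ ^ 2 := pow_le_pow_left₀ (by positivity) h1.le 2
        linarith [(hd_le θ).2]
      have h5 := mul_le_mul_of_nonneg_left hint (mul_pos hn' hmean).le
      simp only
      rw [← hm, ← mul_assoc]
      nlinarith
  · rw [← ENNReal.ofReal_toReal hN.ne, ← ENNReal.ofReal_mul (by positivity),
      ← ENNReal.ofReal_mul (by positivity), ← ENNReal.ofReal_ofNat,
      ← ENNReal.ofReal_mul (by positivity), ← ENNReal.ofReal_div_of_pos ha,
      ENNReal.toReal_ofReal ENNReal.toReal_nonneg]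
    congr 1
    rw [hb, Real.mul_rpow (by norm_num) ht0.le, Real.rpow_sub ht0, Real.rpow_two]
    have hs0 : 0 < Real.sqrt n := Real.sqrt_pos.2 hn'
    field_simp
    rw [Real.sq_sqrt hn'.le]
    ring

/-- Consistency at rate `ε` of any `T` satisfying the basic inequality with i.i.d. weights, the
prior term being multiplied by a tight nonnegative factor `s`. -/
theorem tendsto_of_basic_inequality {𝓧 Θ : Type*} [MeasurableSpace 𝓧]
    (P₀ : Measure 𝓧) [IsProbabilityMeasure P₀] (p : Θ → 𝓧 → ℝ) (θ₀ : Θ)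
    (prior : ℕ → Θ → ℝ≥0) (hprior : ∀ n, 0 < n → 0 < prior n θ₀) (d : Θ → Θ → ℝ)
    (hd_le : ∀ θ, Integrable (fun x => Real.log (p θ₀ x / p θ x)) P₀ ∧
      d θ θ₀ ^ 2 ≤ ∫ x, Real.log (p θ₀ x / p θ x) ∂P₀)
    (ν : Measure ℝ) [IsProbabilityMeasure ν] (hν : Integrable (fun y => y) ν)
    (hmean : 0 < ∫ y, y ∂ν) (hN : norm21 ν < ∞)
    (ε : ℕ → ℝ) (hε_pos : ∀ n, 0 < n → 0 < ε n)
    (hratio : limsup (fun n => priorRatio (prior n) d θ₀ n (ε n)) atTop ≤ 0)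
    (hgrowth : ∃ C : ℝ, 0 < C ∧ ∃ γ : ℝ, 0 < γ ∧ γ < 2 ∧
      ∀ n k : ℕ, 0 < k → k ≤ n → ∀ e : ℝ, ε n ≤ e → ∀ c : ℝ, 1 < c →
        phi P₀ p d θ₀ k e ≤ ENNReal.ofReal (C * Real.sqrt n * e ^ 2) ∧
        phi P₀ p d θ₀ k (c * e) ≤ ENNReal.ofReal (c ^ γ) * phi P₀ p d θ₀ k e)
    (s : (n : ℕ) → (Fin n → ℝ) → ℝ)
    (hs : ∀ η : ℝ≥0∞, 0 < η → ∃ K : ℝ, 0 < K ∧ ∀ n, 0 < n →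
      (Measure.pi fun _ : Fin n => ν) {v | K < s n v} ≤ η)
    (T : (n : ℕ) → (Fin n → 𝓧) → (Fin n → ℝ) → Θ)
    (hT : ∀ n, 0 < n → ∀ᵐ q ∂((sampleLaw P₀ n).prod (Measure.pi fun _ : Fin n => ν)),
      0 ≤ s n q.2 ∧ 0 < prior n (T n q.1 q.2) ∧
      0 ≤ ∑ i, q.2 i * Real.log (p (T n q.1 q.2) (q.1 i) / p θ₀ (q.1 i)) +
        s n q.2 * Real.log (prior n (T n q.1 q.2) / prior n θ₀))
    (M : ℕ → ℝ) (hM : Tendsto M atTop atTop) :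
    Tendsto (fun n => ((sampleLaw P₀ n).prod (Measure.pi fun _ : Fin n => ν))
      {q | M n * ε n < d (T n q.1 q.2) θ₀}) atTop (𝓝 0) := by
  obtain ⟨C, hC, γ, hγ0, hγ2, hgrowth⟩ := hgrowth
  set m := ∫ y, y ∂ν with hm
  set D : ℝ := 8 * (norm21 ν).toReal * C * 4 ^ γ / m with hD
  have hD0 : 0 ≤ D := by positivity
  -- Doubling the radius multiplies the bound `t ^ (γ - 2)` by `ρ < 1`.
  set ρ : ℝ := 2 ^ (γ - 2) with hρ
  have hρ0 : 0 < ρ := by positivity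
  have hρ1 : ρ < 1 := Real.rpow_lt_one_of_one_lt_of_neg (by norm_num) (by linarith)
  have hlim : Tendsto (fun n => ENNReal.ofReal (D * M n ^ (γ - 2) * (1 - ρ)⁻¹)) atTop (𝓝 0) := by
    have h1 : Tendsto (fun n => M n ^ (γ - 2)) atTop (𝓝 0) := by
      have := (tendsto_rpow_neg_atTop (y := 2 - γ) (by linarith)).comp hM
      simpa [Function.comp_def] using this
    have h2 := ENNReal.tendsto_ofReal ((h1.const_mul D).mul_const (1 - ρ)⁻¹)
    simpa using h2
  rw [ENNReal.tendsto_nhds_zero]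
  intro η hη
  have hη2 : 0 < η / 2 := ENNReal.half_pos hη.ne'
  obtain ⟨K, hK, hKs⟩ := hs (η / 2) hη2
  -- With `s ≤ K`, the slack `m / (2K)` limits the prior term to half of the lower bound `m n e²` on
  -- the expected loss.
  have hδ : 0 < m / (2 * K) := by positivity
  have hev : ∀ᶠ n in atTop, priorRatio (prior n) d θ₀ n (ε n) < ((m / (2 * K) : ℝ) : EReal) :=
    eventually_lt_of_limsup_lt (hratio.trans_lt (EReal.coe_pos.2 hδ))
  filter_upwards [hev, hM.eventually_ge_atTop 1, eventually_gt_atTop 0,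
    ENNReal.tendsto_nhds_zero.1 hlim _ hη2] with n hnr hM1 hn hnl
  have hε := hε_pos n hn
  have : IsProbabilityMeasure (sampleLaw P₀ n) := by unfold sampleLaw; infer_instance
  set μ := (sampleLaw P₀ n).prod (Measure.pi fun _ : Fin n => ν) with hμ
  let A : ℕ → Set ((Fin n → 𝓧) × (Fin n → ℝ)) := fun j => {q | ∃ θ,
      2 ^ j * M n * ε n < d θ θ₀ ∧ d θ θ₀ ≤ 2 * (2 ^ j * M n * ε n) ∧
      -(m / 2 * (n * (2 ^ j * M n * ε n) ^ 2)) ≤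
        ∑ i, q.2 i * Real.log (p θ (q.1 i) / p θ₀ (q.1 i))}
  have hA : ∀ j, μ (A j) ≤ ENNReal.ofReal (D * M n ^ (γ - 2) * ρ ^ j) := by
    intro j
    have h1 : (1 : ℝ) ≤ 2 ^ j := one_le_pow₀ (by norm_num)
    refine (measure_shell_le P₀ p θ₀ d hd_le ν hν hmean hN hn hε hC
      (fun k hk hkn c hc => hgrowth n k hk hkn (ε n) le_rfl c hc)
      (t := 2 ^ j * M n) (by nlinarith)).trans (le_of_eq ?_)
    congr 1
    rw [Real.mul_rpow (by positivity) (by linarith), ← hm, ← hD, hρ, ← Real.rpow_natCast,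
      ← Real.rpow_natCast, ← Real.rpow_mul (by norm_num), ← Real.rpow_mul (by norm_num),
      mul_comm (j : ℝ)]
    ring
  have hcover : {q : (Fin n → 𝓧) × (Fin n → ℝ) | M n * ε n < d (T n q.1 q.2) θ₀} ≤ᵐ[μ]
      ((Set.univ ×ˢ {v | K < s n v}) ∪ ⋃ j, A j : Set _) := by
    filter_upwards [hT n hn] with q hq hqd
    obtain ⟨hs0, hpr, hbasic⟩ := hq
    by_cases hKq : K < s n q.2
    · exact Or.inl ⟨trivial, hKq⟩
    right
    have hMε : 0 < M n * ε n := by positivity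
    obtain ⟨j, hj1, hj2⟩ := exists_dyadic_shell hMε hqd
    rw [← mul_assoc (2 ^ j)] at hj1 hj2
    refine Set.mem_iUnion.2 ⟨j, T n q.1 q.2, hj1, hj2, ?_⟩
    have h1 : (1 : ℝ) ≤ 2 ^ j := one_le_pow₀ (by norm_num)
    have h2 : (1 : ℝ) ≤ 2 ^ j * M n := by nlinarith
    have hlog := log_prior_le_of_priorRatio_lt hnr hn (e := 2 ^ j * M n * ε n)
      (by nlinarith) (by positivity) hj1 hj2 hpr (hprior n hn)
    set L := Real.log (prior n (T n q.1 q.2) / prior n θ₀)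
    set X : ℝ := n * (2 ^ j * M n * ε n) ^ 2
    have hX : 0 ≤ X := by positivity
    have h3 : s n q.2 * L ≤ K * (X * (m / (2 * K))) :=
      (mul_le_mul_of_nonneg_left hlog hs0).trans
        (mul_le_mul_of_nonneg_right (not_lt.1 hKq) (by positivity))
    have h4 : K * (X * (m / (2 * K))) = m / 2 * X := by field_simp
    change -(m / 2 * X) ≤ _
    linarith
  calc μ {q | M n * ε n < d (T n q.1 q.2) θ₀}
      ≤ μ ((Set.univ ×ˢ {v | K < s n v}) ∪ ⋃ j, A j) := measure_mono_ae hcover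
    _ ≤ η / 2 + ∑' j, ENNReal.ofReal (D * M n ^ (γ - 2) * ρ ^ j) := by
        refine (measure_union_le _ _).trans (add_le_add ?_ ?_)
        · rw [hμ, Measure.prod_prod, measure_univ, one_mul]
          exact hKs n hn
        · exact (measure_iUnion_le _).trans (ENNReal.tsum_le_tsum hA)
    _ ≤ η / 2 + η / 2 := by
        gcongr
        have hM0 : 0 ≤ M n := by linarith
        rw [← ENNReal.ofReal_tsum_of_nonneg (fun j => by positivity)
          ((summable_geometric_of_lt_one hρ0.le hρ1).mul_left _), tsum_mul_left,
          tsum_geometric_of_lt_one hρ0.le hρ1]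
        exact hnl
    _ = η := ENNReal.add_halves η

/-! ### Removing the Dirichlet normalization -/

/-- The mean of i.i.d. random variables with finite expectation is bounded in probability. -/
theorem exists_measure_mean_gt_le (ν : Measure ℝ) [IsProbabilityMeasure ν]
    (hν : Integrable (fun y => y) ν) {η : ℝ≥0∞} (hη : 0 < η) :
    ∃ K : ℝ, 0 < K ∧ ∀ n, 0 < n →
      (Measure.pi fun _ : Fin n => ν) {v | K < (∑ i, v i) / n} ≤ η := by
  set I := ∫⁻ y, ENNReal.ofReal y ∂ν with hI
  have hIfin : I ≠ ∞ := ((lintegral_mono fun y => Real.ofReal_le_enorm y).trans_lt hν.2).ne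
  -- Markov's inequality for the positive parts requires `I ≤ η K`; the `+ 1` keeps `K` positive
  -- when `I / η = 0`.
  refine ⟨(I / η).toReal + 1, by positivity, fun n hn => ?_⟩
  set K := (I / η).toReal + 1 with hKdef
  have hK : 0 < K := by positivity
  have hn' : (0 : ℝ) < n := Nat.cast_pos.2 hn
  have hIK : I ≤ η * ENNReal.ofReal K := by
    have h1 : I / η ≤ ENNReal.ofReal K := by
      rw [← ENNReal.ofReal_toReal (ENNReal.div_ne_top hIfin hη.ne')]
      exact ENNReal.ofReal_le_ofReal (by linarith)
    rcases eq_or_ne η ∞ with rfl | hfin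
    · simp [ENNReal.top_mul, hK]
    · rw [mul_comm]
      exact (ENNReal.div_le_iff hη.ne' hfin).1 h1
  have hm : Measurable fun v : Fin n → ℝ => ∑ i, ENNReal.ofReal (v i) := by fun_prop
  have hint : ∫⁻ v, ∑ i, ENNReal.ofReal (v i) ∂(Measure.pi fun _ : Fin n => ν) = n * I := by
    rw [lintegral_finsetSum _ fun i _ => by fun_prop]
    have : ∀ i : Fin n, ∫⁻ v, ENNReal.ofReal (v i) ∂(Measure.pi fun _ : Fin n => ν) = I := fun i =>
      (measurePreserving_eval (fun _ : Fin n => ν) i).lintegral_comp ENNReal.measurable_ofReal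
    simp [this]
  have hmarkov := meas_ge_le_lintegral_div (μ := Measure.pi fun _ : Fin n => ν) hm.aemeasurable
    (ε := ENNReal.ofReal (K * n)) (by simpa using mul_pos hK hn') ENNReal.ofReal_ne_top
  refine (measure_mono fun v hv => ?_).trans (hmarkov.trans ?_)
  · have hv' : K < (∑ i, v i) / n := hv
    refine (ENNReal.ofReal_le_ofReal ((lt_div_iff₀ hn').1 hv').le).trans ?_
    calc ENNReal.ofReal (∑ i, v i) ≤ ENNReal.ofReal (∑ i, max (v i) 0) :=
          ENNReal.ofReal_le_ofReal (Finset.sum_le_sum fun i _ => le_max_left _ _)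
      _ = ∑ i, ENNReal.ofReal (v i) := by
          rw [ENNReal.ofReal_sum_of_nonneg fun i _ => le_max_right _ _]
          simp [ENNReal.ofReal_max]
  · rw [hint]
    refine ENNReal.div_le_of_le_mul ?_
    rw [ENNReal.ofReal_mul hK.le, ENNReal.ofReal_natCast]
    calc n * I ≤ n * (η * ENNReal.ofReal K) := mul_le_mul_right hIK _
      _ = _ := by ring

/-- Multiplying by the positive mean of `z` cancels the normalization of the weights and moves it
onto the prior term. -/
theorem basic_inequality_of_normalized {n : ℕ} (hn : 0 < n) {z a : Fin n → ℝ} {L : ℝ}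
    (hz : 0 < ∑ i, z i) (h : 0 ≤ ∑ i, n * (z i / ∑ j, z j) * a i + L) :
    0 ≤ ∑ i, z i * a i + (∑ i, z i) / n * L := by
  have hn' : (0 : ℝ) < n := Nat.cast_pos.2 hn
  have h1 : ∑ i, n * (z i / ∑ j, z j) * a i = n / (∑ j, z j) * ∑ i, z i * a i := by
    rw [Finset.mul_sum]
    exact Finset.sum_congr rfl fun i _ => by ring
  rw [h1] at h
  have h2 := mul_nonneg (div_pos hz hn').le h
  have h3 : (∑ i, z i) / n * (n / (∑ j, z j) * ∑ i, z i * a i + L) =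
      ∑ i, z i * a i + (∑ i, z i) / n * L := by
    field_simp
  rwa [h3] at h2

end WeightedMode

/-! ### The two weight schemes -/

theorem theorem2 {𝓧 Θ : Type*} [MeasurableSpace 𝓧]
    (P₀ : Measure 𝓧) [IsProbabilityMeasure P₀]
    -- the exponentiated loss `p_θ(x) = exp (-l(θ; x))`
    (p : Θ → 𝓧 → ℝ) (hp_pos : ∀ θ x, 0 < p θ x) (hp_meas : ∀ θ, Measurable (p θ))
    (θ₀ : Θ)
    -- the prior densities `πₙ`
    (prior : ℕ → Θ → ℝ≥0) (hprior : ∀ n, 0 < n → 0 < prior n θ₀)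
    -- (1) the semi-metric
    (d : Θ → Θ → ℝ) (hd : IsSemimetric d)
    (hd_le : ∀ θ, Integrable (fun x => Real.log (p θ₀ x / p θ x)) P₀ ∧
      d θ θ₀ ^ 2 ≤ ∫ x, Real.log (p θ₀ x / p θ x) ∂P₀)
    -- (2) bounded loss
    (hbdd : ∀ᵐ x ∂P₀, BddAbove (Set.range fun θ => |Real.log (p θ x)|))
    -- (3) the laws of the weights
    (Q : (n : ℕ) → Measure (Fin n → ℝ))
    (hQ : IsIIDWeightLaw Q ∨ IsDirichletWeightLaw Q)
    -- the rate
    (ε : ℕ → ℝ) (hε_pos : ∀ n, 0 < n → 0 < ε n) (hε : Tendsto ε atTop (𝓝 0))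
    (hrate : ∀ n, 0 < n →
      (ENNReal.ofReal (ε n ^ 2))⁻¹ * phi P₀ p d θ₀ n (ε n) ≤ ENNReal.ofReal (Real.sqrt n))
    (hratio : limsup (fun n => priorRatio (prior n) d θ₀ n (ε n)) atTop ≤ 0)
    -- (4) growth of the Rademacher complexity
    (hgrowth : ∃ C : ℝ, 0 < C ∧ ∃ γ : ℝ, 0 < γ ∧ γ < 2 ∧
      ∀ n k : ℕ, 0 < k → k ≤ n → ∀ e : ℝ, ε n ≤ e → ∀ c : ℝ, 1 < c →
        phi P₀ p d θ₀ k e ≤ ENNReal.ofReal (C * Real.sqrt n * e ^ 2) ∧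
        phi P₀ p d θ₀ k (c * e) ≤ ENNReal.ofReal (c ^ γ) * phi P₀ p d θ₀ k e)
    -- the weighted posterior modes
    (θhat : (n : ℕ) → (Fin n → 𝓧) → (Fin n → ℝ) → Θ)
    (hθhat : ∀ n, 0 < n → ∀ᵐ q ∂((sampleLaw P₀ n).prod (Q n)),
      IsMode p (prior n) q.1 q.2 (θhat n q.1 q.2))
    (M : ℕ → ℝ) (hM : Tendsto M atTop atTop) :
    Tendsto (fun n => ((sampleLaw P₀ n).prod (Q n))
      {q | M n * ε n < d (θhat n q.1 q.2) θ₀}) atTop (𝓝 0) := by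
  rcases hQ with ⟨ν, hνp, hν, hmean, hN, hQ⟩ | ⟨c, hc, hQ⟩
  · simp only [hQ] at hθhat ⊢
    -- I.i.d. weights need no rescaling: the factor is `1`, and `K = 1` makes its exceedance event
    -- empty.
    refine tendsto_of_basic_inequality P₀ p θ₀ prior hprior d hd_le ν hν (hmean ▸ one_pos) hN ε
      hε_pos hratio hgrowth (fun _ _ => 1) (fun η _ => ⟨1, one_pos, fun n _ => by simp⟩) θhat
      (fun n hn => ?_) M hM
    filter_upwards [hθhat n hn] with q hq
    obtain ⟨h1, h2⟩ := hq.basic_inequality hp_pos (hprior n hn)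
    exact ⟨zero_le_one, h1, by simpa using h2⟩
  · have hνp := isProbabilityMeasure_gammaMeasure hc one_pos
    have hν := integrable_gammaMeasure hc
    let g : (n : ℕ) → (Fin n → ℝ) → Fin n → ℝ := fun n z i => n * (z i / ∑ j, z j)
    have hg : ∀ n, Measurable (g n) := fun n => by fun_prop
    have hQg : ∀ n, Q n = (Measure.pi fun _ : Fin n => gammaMeasure c 1).map (g n) := hQ
    have : ∀ n, IsProbabilityMeasure (sampleLaw P₀ n) := fun n => by
      unfold sampleLaw
      infer_instance
    -- The mode becomes a function of the gamma vector, with the sample mean of that vector as prior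
    -- factor.
    refine tendsto_of_tendsto_of_tendsto_of_le_of_le tendsto_const_nhds
      (tendsto_of_basic_inequality P₀ p θ₀ prior hprior d hd_le (gammaMeasure c 1) hν
        (integral_gammaMeasure_pos hc) (norm21_gammaMeasure_lt_top hc) ε hε_pos hratio hgrowth
        (fun n z => (∑ i, z i) / n) (fun η hη => exists_measure_mean_gt_le _ hν hη)
        (fun n x z => θhat n x (g n z)) (fun n hn => ?_) M hM)
      (fun _ => zero_le) (fun n => ?_)
    · have hmode : ∀ᵐ q ∂((sampleLaw P₀ n).prod (Measure.pi fun _ : Fin n => gammaMeasure c 1)),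
          IsMode p (prior n) q.1 (g n q.2) (θhat n q.1 (g n q.2)) := by
        have h := hθhat n hn
        have hmap := ((MeasurePreserving.id (sampleLaw P₀ n)).prod
          ((hg n).measurePreserving (Measure.pi fun _ : Fin n => gammaMeasure c 1)))
        rw [hQg n] at h
        exact hmap.quasiMeasurePreserving.ae h
      have hpos : ∀ᵐ q ∂((sampleLaw P₀ n).prod (Measure.pi fun _ : Fin n => gammaMeasure c 1)),
          ∀ i, 0 < q.2 i := by
        refine Measure.quasiMeasurePreserving_snd.ae (p := fun z : Fin n → ℝ => ∀ i, 0 < z i) ?_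
        exact ae_all_iff.2 fun i => (measurePreserving_eval
          (fun _ : Fin n => gammaMeasure c 1) i).quasiMeasurePreserving.ae (ae_pos_gammaMeasure c 1)
      filter_upwards [hmode, hpos] with q hq hz
      have : Nonempty (Fin n) := ⟨⟨0, hn⟩⟩
      have hsum : 0 < ∑ i, q.2 i := Finset.sum_pos (fun i _ => hz i) Finset.univ_nonempty
      obtain ⟨h1, h2⟩ := hq.basic_inequality hp_pos (hprior n hn)
      exact ⟨by positivity, h1, basic_inequality_of_normalized hn hsum h2⟩
    -- The event may be non-measurable, so passing to the gamma vector needs the outer measure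
    -- comparison.
    · change ((sampleLaw P₀ n).prod (Q n)) {q | M n * ε n < d (θhat n q.1 q.2) θ₀} ≤ _
      rw [hQg n]
      exact prod_map_le_preimage (sampleLaw P₀ n) _ (hg n) _
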